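/- Let $A_t=\begin{pmatrix}0&1\\1&0\end{pmatrix}$ for odd $t$ and $A_t=\begin{pmatrix}0&-1\\-1&0\end{pmatrix}$ for even $t$ $(t\in\mathbb Z,\ t\ge -1)$, and let $\Delta_2=\{(u_1,u_2): u_1,u_2\ge 0,\ u_1+u_2=1\}$. For a step size $\eta>0$ and initial strategies $(\mathbf x_1^{-1},\mathbf x_2^{-1}),(\mathbf x_1^{0},\mathbf x_2^{0})\in\Delta_2\times\Delta_2$, Optimistic MWU in the 2-periodic zero-sum game $(A_t)$ is defined for $t\ge 0$ and $i\in\{1,2\}$ by $$\mathbf x_{1,i}^{t+1}=\frac{\mathbf x_{1,i}^{t}\,e^{2\eta (A_t\mathbf x_2^t)_i-\eta(A_{t-1}\mathbf x_2^{t-1})_i}}{\sum_{s=1}^2\mathbf x_{1,s}^{t}\,e^{2\eta (A_t\mathbf x_2^t)_s-\eta(A_{t-1}\mathbf x_2^{t-1})_s}},\qquad \mathbf x_{2,i}^{t+1}=\frac{\mathbf x_{2,i}^{t}\,e^{-2\eta (A_t^\top\mathbf x_1^t)_i+\eta(A_{t-1}^\top\mathbf x_1^{t-1})_i}}{\sum_{s=1}^2\mathbf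 x_{2,s}^{t}\,e^{-2\eta (A_t^\top\mathbf x_1^t)_s+\eta(A_{t-1}^\top\mathbf x_1^{t-1})_s}}.$$ Let $\mathbf x_1^*=\mathbf x_2^*=(\tfrac12,\tfrac12)$ be the equilibrium, and let $$\mathrm{KL}\big((\mathbf x_1^*,\mathbf x_2^*),(\mathbf x_1,\mathbf x_2)\big)=\sum_{j=1}^2\sum_{i=1}^2\mathbf x_{j,i}^*\ln\frac{\mathbf x_{j,i}^*}{\mathbf x_{j,i}}\in[0,+\infty],$$ which is $+\infty$ if some $\mathbf x_{j,i}=0$. Then, for sufficiently small $\eta$ and every initial point $(\mathbf x_1^0,\mathbf x_2^0)\ne(\mathbf x_1^*,\mathbf x_2^*)$, $$\lim_{t\to\infty}\mathrm{KL}\big((\mathbf x_1^*,\mathbf x_2^*),(\mathbf x_1^t,\mathbf x_2^t)\big)=+\infty,$$ and $(\mathbf x_1^t,\mathbf x_2^t)$ does not converge to $(\mathbf x_1^*,\mathbf x_2^*)$, in each of the following two senses. 1. For every $(\mathbf x_1^0,\mathbf x_2^0)\ne(\mathbf x_1^*,\mathbf x_2^*)$ in $\Delta_2\times\Delta_2$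 the conclusion holds for every $(\mathbf x_1^{-1},\mathbf x_2^{-1})\in\Delta_2\times\Delta_2$ and every $\eta>0$ with $16\sqrt\eta\le p$, where $p=\tfrac12\max\big(|\mathbf x_{1,1}^0-\tfrac12|,|\mathbf x_{2,1}^0-\tfrac12|\big)$. 2. There is an absolute constant $\eta_0>0$ such that, for every $0<\eta<\eta_0$, the conclusion holds for every $(\mathbf x_1^0,\mathbf x_2^0)\ne(\mathbf x_1^*,\mathbf x_2^*)$ in $\Delta_2\times\Delta_2$ with $(\mathbf x_1^{-1},\mathbf x_2^{-1})=(\mathbf x_1^0,\mathbf x_2^0)$. -/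

import Mathlib

open Filter Topology

noncomputable section

/-- A pair of strategy vectors, one for each player. -/
abbrev Profile (m n : ℕ) : Type := (Fin m → ℝ) × (Fin n → ℝ)

/-- The set of pairs of mixed strategies. -/
def mixedProfiles (m n : ℕ) : Set (Profile m n) :=
  stdSimplex ℝ (Fin m) ×ˢ stdSimplex ℝ (Fin n)

/-- Multiplicative weights: the weight `x i` is multiplied by `exp (g i)`, then normalized. -/
def mwUpdate {n : ℕ} (x g : Fin n → ℝ) : Fin n → ℝ :=
  fun i => x i * Real.exp (g i) / ∑ s, x s * Real.exp (g s)

/-- One step of Optimistic MWU. `A` is the current payoff matrix and `A'` the previous one, `z` is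
the current profile and `z'` the previous one. Player 1 maximizes `x₁ᵀ A x₂`, player 2 minimizes
it. -/
def omwuStep {m n : ℕ} (η : ℝ) (A' A : Matrix (Fin m) (Fin n) ℝ) (z' z : Profile m n) :
    Profile m n :=
  (mwUpdate z.1 ((2 * η) • A.mulVec z.2 - η • A'.mulVec z'.2),
   mwUpdate z.2 (-((2 * η) • A.transpose.mulVec z.1 - η • A'.transpose.mulVec z'.1)))

/-- The pair (profile at time `t - 1`, profile at time `t`) of Optimistic MWU in the time-varying
zero-sum game `A`, started from the profile `zm` at time `-1` and `z0` at time `0`. -/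
def omwuPair {m n : ℕ} (η : ℝ) (A : ℤ → Matrix (Fin m) (Fin n) ℝ) (zm z0 : Profile m n) :
    ℕ → Profile m n × Profile m n
  | 0 => (zm, z0)
  | t + 1 =>
    ((omwuPair η A zm z0 t).2,
      omwuStep η (A ((t : ℤ) - 1)) (A (t : ℤ))
        (omwuPair η A zm z0 t).1 (omwuPair η A zm z0 t).2)

/-- The profile of Optimistic MWU at time `t`. -/
def omwu {m n : ℕ} (η : ℝ) (A : ℤ → Matrix (Fin m) (Fin n) ℝ) (zm z0 : Profile m n) (t : ℕ) :
    Profile m n :=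
  (omwuPair η A zm z0 t).2

/-- The payoff matrices of the 2-periodic game. -/
def periodicGame (t : ℤ) : Matrix (Fin 2) (Fin 2) ℝ :=
  if Odd t then !![0, 1; 1, 0] else !![0, -1; -1, 0]

/-- The equilibrium of the 2-periodic game. -/
def equilibrium : Profile 2 2 := (![1 / 2, 1 / 2], ![1 / 2, 1 / 2])

open Classical in
/-- The Kullback–Leibler divergence of probability vectors; it is infinite if `q` vanishes
somewhere where `p` does not. -/
def klVec {n : ℕ} (p q : Fin n → ℝ) : EReal :=
  if ∃ i, p i ≠ 0 ∧ q i = 0 then ⊤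
  else ((∑ i, p i * Real.log (p i / q i) : ℝ) : EReal)

/-- The KL-divergence of profiles: the sum over the two players. -/
def klProfile {m n : ℕ} (w z : Profile m n) : EReal :=
  klVec w.1 z.1 + klVec w.2 z.2

end

/-! In log-odds coordinates $X_n,Y_n$ a strategy is described by its bias $\tanh(z/2)$, and each
step adds to one player's log-odds $\pm\eta$ times a combination of the other player's biases. The
payoff matrix changes sign at every step, so the log-odds zigzag, and the motion shows only over two
steps.

Far from equilibrium, suppose the bias of $Y$ is large compared to $\eta$. Then $X_{n+2}$ and
$X_{n+4}$ lie on the same side of $X_{n+3}$, at comparable distances, and the optimistic weights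
$2,-1,-1$ give $Y$ a push away from $0$ of order $\eta^3 e^{-|X_{n+3}|}$ (`snd_two_step_le`). The
push keeps the bias large, so it acts forever, and either $Y$ is unbounded or the pushes are
summable, which forces $|X|\to\infty$ (`tendsto_abs_add_abs_of_increments`). This settles the first
claim.

Near equilibrium the two-step map is, up to $O(\eta^3)$, multiplication by $1+\tfrac34\eta^2$
(`abs_fst_two_step_sub_le`). An orbit starting at rest therefore grows until a bias reaches $20\eta$
(`exists_le_abs_bias`), and the first regime takes over.

KL to the uniform profile is at least half the total absolute log-odds up to a constant. On the
boundary it is identically infinite. -/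

noncomputable section

/-! ### Estimates for the bias function -/

/-- The difference between the two weights of the mixed strategy with log-odds `z`; it equals
`tanh (z / 2)`. -/
def bias (z : ℝ) : ℝ := 2 * Real.sigmoid z - 1

lemma bias_eq_div (z : ℝ) : bias z = (Real.exp z - 1) / (Real.exp z + 1) := by
  have h := Real.exp_pos z
  rw [bias, Real.sigmoid_def, Real.exp_neg]
  field_simp
  ring

lemma bias_neg (z : ℝ) : bias (-z) = -bias z := by
  rw [bias, bias, Real.sigmoid_neg]; ring

lemma bias_mono : Monotone bias := fun a b h => by
  have := Real.sigmoid_monotone h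
  simp only [bias]; linarith

lemma abs_bias_le_one (z : ℝ) : |bias z| ≤ 1 := by
  rw [abs_le, bias]
  constructor <;> linarith [Real.sigmoid_nonneg z, Real.sigmoid_le_one z]

lemma abs_bias_sub_le (a b : ℝ) : |bias a - bias b| ≤ |a - b| / 2 := by
  have h := Convex.norm_image_sub_le_of_norm_hasDerivWithin_le (f := Real.sigmoid)
    (f' := fun x => Real.sigmoid x * (1 - Real.sigmoid x)) (C := 1 / 4) (s := Set.univ)
    (fun x _ => (Real.hasDerivAt_sigmoid x).hasDerivWithinAt)
    (fun x _ => by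
      have h0 := Real.sigmoid_nonneg x
      have h1 := Real.sigmoid_le_one x
      rw [Real.norm_eq_abs, abs_of_nonneg (mul_nonneg h0 (by linarith))]
      nlinarith [sq_nonneg (2 * Real.sigmoid x - 1)])
    convex_univ (Set.mem_univ b) (Set.mem_univ a)
  rw [Real.norm_eq_abs, Real.norm_eq_abs] at h
  have : bias a - bias b = 2 * (Real.sigmoid a - Real.sigmoid b) := by simp only [bias]; ring
  rw [this, abs_mul, abs_two]
  linarith

lemma bias_zero : bias 0 = 0 := by norm_num [bias]

lemma abs_bias_le (z : ℝ) : |bias z| ≤ |z| / 2 := by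
  simpa [bias_zero] using abs_bias_sub_le z 0

lemma abs_bias_sub_half_le {z : ℝ} (hz : |z| ≤ 1) : |bias z - z / 2| ≤ |z| ^ 3 := by
  have hr := Real.exp_bound hz (n := 3) (by norm_num)
  norm_num [Finset.sum_range_succ, Nat.factorial] at hr
  set r := Real.exp z - (1 + z + z ^ 2 / 2) with hrd
  have he : Real.exp z = 1 + z + z ^ 2 / 2 + r := by rw [hrd]; ring
  have hpos := Real.exp_pos z
  have key : bias z - z / 2 = (2 * r - z ^ 3 / 2 - z * r) / (2 * (Real.exp z + 1)) := by
    rw [bias_eq_div, div_sub' (by positivity), div_eq_div_iff (by positivity) (by positivity), he]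
    ring
  rw [key, abs_div, abs_of_pos (a := 2 * (Real.exp z + 1)) (by positivity),
    div_le_iff₀ (by positivity)]
  have h3 : 0 ≤ |z| ^ 3 := by positivity
  have h1 : |z * r| ≤ |z| ^ 3 * (2 / 9) := by
    rw [abs_mul]
    calc |z| * |r| ≤ 1 * |r| := by gcongr
      _ ≤ _ := by linarith
  have h2 : |2 * r| ≤ |z| ^ 3 * (4 / 9) := by rw [abs_mul, abs_two]; linarith
  have h4 : |z ^ 3 / 2| = |z| ^ 3 / 2 := by rw [abs_div, abs_pow, abs_two]
  have h5 := abs_sub (2 * r - z ^ 3 / 2) (z * r)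
  have h6 := abs_sub (2 * r) (z ^ 3 / 2)
  nlinarith

lemma abs_le_three_mul_abs_bias {z : ℝ} (hz : |bias z| ≤ 1 / 3) : |z| ≤ 3 * |bias z| := by
  wlog h : 0 ≤ z generalizing z
  · have := @this (-z) (by rwa [bias_neg, abs_neg]) (by linarith)
    rwa [bias_neg, abs_neg, abs_neg] at this
  have h0 : 0 ≤ bias z := by simpa [bias_zero] using bias_mono h
  rw [abs_of_nonneg h0] at hz ⊢
  rw [abs_of_nonneg h]
  have he := Real.add_one_le_exp z
  have h1 : bias z * (Real.exp z + 1) = Real.exp z - 1 := by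
    rw [bias_eq_div, div_mul_cancel₀]; positivity
  nlinarith

lemma bias_add_sub (x d : ℝ) : bias (x + d) - bias x =
    2 * Real.exp x * (Real.exp d - 1) / ((1 + Real.exp x * Real.exp d) * (1 + Real.exp x)) := by
  have h := Real.exp_pos x
  have h' := Real.exp_pos d
  rw [bias_eq_div, bias_eq_div, Real.exp_add]
  field_simp
  ring

lemma bias_add_sub_le (x : ℝ) {d : ℝ} (hd : 0 ≤ d) : bias (x + d) - bias x ≤
    2 * (Real.exp x / (1 + Real.exp x) ^ 2) * (Real.exp d - 1) := by
  have h := Real.exp_pos x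
  have h' := Real.one_le_exp hd
  rw [bias_add_sub, mul_div_assoc', div_mul_eq_mul_div]
  refine div_le_div_of_nonneg_left (by nlinarith) (by positivity) ?_
  nlinarith [mul_le_mul_of_nonneg_left h' h.le]

lemma le_bias_add_sub (x : ℝ) {d : ℝ} (hd : 0 ≤ d) :
    2 * (Real.exp x / (1 + Real.exp x) ^ 2) * (1 - Real.exp (-d)) ≤ bias (x + d) - bias x := by
  have h := Real.exp_pos x
  have h' := Real.one_le_exp hd
  have hd0 : 0 < Real.exp d := Real.exp_pos d
  rw [bias_add_sub, Real.exp_neg]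
  have e : 2 * (Real.exp x / (1 + Real.exp x) ^ 2) * (1 - (Real.exp d)⁻¹) =
      2 * Real.exp x * (Real.exp d - 1) / ((1 + Real.exp x) ^ 2 * Real.exp d) := by
    field_simp
  rw [e]
  refine div_le_div_of_nonneg_left (by nlinarith) (by positivity) ?_
  nlinarith

/-- Both increments of `bias` from `x` are compared with the same factor $e^x/(1+e^x)^2$, so the
estimate survives saturation at large $|x|$. What remains is $2(1-e^{-d})-(e^{e}-1)\ge d/4$, which
is to first order $2d-e\ge\tfrac34 d$. -/
lemma bias_extrapolation_of_nonneg (x : ℝ) {d e : ℝ} (hd : 0 ≤ d) (hd' : d ≤ 1 / 10) (he : 0 ≤ e)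
    (hed : e ≤ 5 / 4 * d) :
    d * (Real.exp x / (1 + Real.exp x) ^ 2) / 2 ≤ 2 * bias (x + d) - bias x - bias (x + e) := by
  have h1 := le_bias_add_sub x hd
  have h2 := bias_add_sub_le x he
  set w := Real.exp x / (1 + Real.exp x) ^ 2 with hw
  have hw0 : 0 ≤ w := by positivity
  have h3 := (abs_le.1 (Real.abs_exp_sub_one_sub_id_le (x := -d)
    (by rw [abs_neg, abs_of_nonneg hd]; linarith))).2
  have h4 := (abs_le.1 (Real.abs_exp_sub_one_sub_id_le (x := e)
    (by rw [abs_of_nonneg he]; linarith))).2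
  have h5 : d / 4 ≤ 2 * (1 - Real.exp (-d)) - (Real.exp e - 1) := by nlinarith
  nlinarith [mul_le_mul_of_nonneg_left h5 hw0]

lemma exp_neg_div_one_add_sq (x : ℝ) :
    Real.exp (-x) / (1 + Real.exp (-x)) ^ 2 = Real.exp x / (1 + Real.exp x) ^ 2 := by
  have h := Real.exp_pos x
  rw [Real.exp_neg]
  field_simp
  ring

lemma bias_extrapolation (x : ℝ) {s d e : ℝ} (hs : s = 1 ∨ s = -1) (hd : 0 ≤ d)
    (hd' : d ≤ 1 / 10) (he : 0 ≤ e) (hed : e ≤ 5 / 4 * d) :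
    d * (Real.exp x / (1 + Real.exp x) ^ 2) / 2 ≤
      s * (2 * bias (x + s * d) - bias x - bias (x + s * e)) := by
  rcases hs with rfl | rfl
  · simpa using bias_extrapolation_of_nonneg x hd hd' he hed
  · have := bias_extrapolation_of_nonneg (-x) hd hd' he hed
    rw [exp_neg_div_one_add_sq, bias_neg, show -x + d = -(x + -1 * d) by ring,
      show -x + e = -(x + -1 * e) by ring, bias_neg, bias_neg] at this
    linarith

lemma exp_neg_abs_le (x : ℝ) :
    Real.exp (-|x|) / 4 ≤ Real.exp x / (1 + Real.exp x) ^ 2 := by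
  wlog h : x ≤ 0 generalizing x
  · have := this (-x) (by linarith)
    rwa [exp_neg_div_one_add_sq, abs_neg] at this
  rw [abs_of_nonpos h, neg_neg]
  have h0 := Real.exp_pos x
  have h1 := Real.exp_le_one_iff.2 h
  refine div_le_div_of_nonneg_left h0.le (by positivity) ?_
  nlinarith

lemma sigmoid_mul_le (x : ℝ) : Real.sigmoid x * (1 - Real.sigmoid x) ≤ Real.exp (-|x|) := by
  wlog h : 0 ≤ x generalizing x
  · have := this (-x) (by linarith)
    rw [Real.sigmoid_neg, abs_neg] at this
    linarith
  rw [abs_of_nonneg h, ← Real.sigmoid_neg, ← Real.sigmoid_mul_rexp_neg]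
  have h0 := Real.sigmoid_nonneg x
  have h1 := Real.sigmoid_le_one x
  have := mul_le_one₀ h1 h0 h1
  nlinarith [Real.exp_pos (-x)]

/-! ### Orbits in log-odds coordinates and the two-step drift -/

/-- Log-odds sequences `X`, `Y` of the two players under the dynamics with step size `η` in a game
whose sign `s` alternates. -/
structure IsLogOddsOrbit (η : ℝ) (s X Y : ℕ → ℝ) : Prop where
  sign : ∀ n, s n = 1 ∨ s n = -1
  alternating : ∀ n, s (n + 1) = -s n
  fst_step : ∀ n, X (n + 2) = X (n + 1) + s n * η * (2 * bias (Y (n + 1)) + bias (Y n))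
  snd_step : ∀ n, Y (n + 2) = Y (n + 1) - s n * η * (2 * bias (X (n + 1)) + bias (X n))

namespace IsLogOddsOrbit

variable {η : ℝ} {s X Y : ℕ → ℝ}

lemma shift (h : IsLogOddsOrbit η s X Y) (k : ℕ) :
    IsLogOddsOrbit η (fun n => s (n + k)) (fun n => X (n + k)) (fun n => Y (n + k)) where
  sign n := h.sign _
  alternating n := by rw [← h.alternating]; congr 1; ring
  fst_step n := by
    have := h.fst_step (n + k)
    rwa [show n + k + 2 = n + 2 + k by ring, show n + k + 1 = n + 1 + k by ring] at this
  snd_step n := by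
    have := h.snd_step (n + k)
    rwa [show n + k + 2 = n + 2 + k by ring, show n + k + 1 = n + 1 + k by ring] at this

/-- The dynamics commute with the quarter turn. -/
lemma rotate (h : IsLogOddsOrbit η s X Y) : IsLogOddsOrbit η s Y (fun n => -X n) where
  sign := h.sign
  alternating := h.alternating
  fst_step n := by rw [h.snd_step, bias_neg, bias_neg]; ring
  snd_step n := by rw [h.fst_step]; ring

lemma abs_sign (h : IsLogOddsOrbit η s X Y) (n : ℕ) : |s n| = 1 := by
  rcases h.sign n with e | e <;> simp [e]

lemma abs_snd_step_le (h : IsLogOddsOrbit η s X Y) (hη : 0 ≤ η) (n : ℕ) :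
    |Y (n + 2) - Y (n + 1)| ≤ η * (2 * |bias (X (n + 1))| + |bias (X n)|) := by
  rw [h.snd_step, sub_sub_cancel_left, abs_neg, abs_mul, abs_mul, h.abs_sign, one_mul,
    abs_of_nonneg hη]
  gcongr
  refine (abs_add_le _ _).trans_eq ?_
  rw [abs_mul, abs_two]

lemma abs_snd_step_le_three_mul (h : IsLogOddsOrbit η s X Y) (hη : 0 ≤ η) (n : ℕ) :
    |Y (n + 2) - Y (n + 1)| ≤ 3 * η := by
  have := h.abs_snd_step_le hη n
  nlinarith [abs_bias_le_one (X (n + 1)), abs_bias_le_one (X n)]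

lemma abs_bias_snd_step_le (h : IsLogOddsOrbit η s X Y) (hη : 0 ≤ η) (n : ℕ) :
    |bias (Y (n + 2)) - bias (Y (n + 1))| ≤ 3 / 2 * η := by
  have := abs_bias_sub_le (Y (n + 2)) (Y (n + 1))
  have := h.abs_snd_step_le_three_mul hη n
  linarith

/-- While the bias of the second player is large compared to the step size, its log-odds increase
over two steps. -/
lemma snd_two_step_le (h : IsLogOddsOrbit η s X Y) (hη : 0 < η) (hη' : η ≤ 1 / 100) (n : ℕ)
    (h1 : 15 * η ≤ bias (Y (n + 1))) (h2 : 15 * η ≤ bias (Y (n + 2)))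
    (h3 : 15 * η ≤ bias (Y (n + 3))) :
    Y (n + 3) + 5 * η ^ 3 * Real.exp (-|X (n + 3)|) ≤ Y (n + 5) := by
  have b2 := abs_le.1 (h.abs_bias_snd_step_le hη.le n)
  have b3 := abs_le.1 (h.abs_bias_snd_step_le hη.le (n + 1))
  simp only [add_assoc, Nat.reduceAdd] at b2 b3
  have u2 := abs_le.1 (abs_bias_le_one (Y (n + 2)))
  have u3 := abs_le.1 (abs_bias_le_one (Y (n + 3)))
  have hsgn : -s (n + 1) = 1 ∨ -s (n + 1) = -1 := by
    rw [← h.alternating]; exact h.sign _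
  -- Since the sign alternates, $X_{n+4}$ and $X_{n+2}$ are reached from $X_{n+3}$ in the same
  -- direction, at distances `d` and `e`. Biases drift by at most $\tfrac32\eta$ per step, so
  -- $e-d\le\tfrac92\eta^2$, while $d\ge45\eta^2$; hence $e\le\tfrac54 d$.
  have key := bias_extrapolation (X (n + 3)) hsgn
    (d := η * (2 * bias (Y (n + 3)) + bias (Y (n + 2))))
    (e := η * (2 * bias (Y (n + 2)) + bias (Y (n + 1))))
    (mul_nonneg hη.le (by linarith)) (by nlinarith) (mul_nonneg hη.le (by linarith))
    (by nlinarith)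
  have x4 := h.fst_step (n + 2)
  have x3 := h.fst_step (n + 1)
  have y5 := h.snd_step (n + 3)
  have y4 := h.snd_step (n + 2)
  have s2 := h.alternating (n + 1)
  have s3 := h.alternating (n + 2)
  simp only [add_assoc, Nat.reduceAdd] at x4 x3 y5 y4 s2 s3
  rw [show X (n + 3) + -s (n + 1) * (η * (2 * bias (Y (n + 3)) + bias (Y (n + 2)))) = X (n + 4) by
      rw [x4, s2]; ring,
    show X (n + 3) + -s (n + 1) * (η * (2 * bias (Y (n + 2)) + bias (Y (n + 1)))) = X (n + 2) by
      rw [x3]; ring] at key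
  have e5 : Y (n + 5) - Y (n + 3) =
      η * (-s (n + 1) * (2 * bias (X (n + 4)) - bias (X (n + 3)) - bias (X (n + 2)))) := by
    rw [y5, y4, s3, s2]; ring
  have hw := exp_neg_abs_le (X (n + 3))
  have hE := Real.exp_pos (-|X (n + 3)|)
  set w := Real.exp (X (n + 3)) / (1 + Real.exp (X (n + 3))) ^ 2 with hwd
  have hd : 45 * η ^ 2 ≤ η * (2 * bias (Y (n + 3)) + bias (Y (n + 2))) := by nlinarith
  have hlow : 45 * η ^ 2 * (Real.exp (-|X (n + 3)|) / 4) / 2 ≤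
      η * (2 * bias (Y (n + 3)) + bias (Y (n + 2))) * w / 2 := by
    have : 0 ≤ η * (2 * bias (Y (n + 3)) + bias (Y (n + 2))) := le_trans (by positivity) hd
    gcongr
  have := mul_le_mul_of_nonneg_left (hlow.trans key) hη.le
  have : 0 ≤ η ^ 3 * Real.exp (-|X (n + 3)|) := by positivity
  nlinarith

end IsLogOddsOrbit

/-- A monotone sequence whose increments are bounded below by `c * exp (-|x k|)` is unbounded
unless `|x k|` tends to infinity. -/
lemma tendsto_abs_add_abs_of_increments {x b : ℕ → ℝ} {c : ℝ} (hc : 0 < c)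
    (h : ∀ k, b k + c * Real.exp (-|x k|) ≤ b (k + 1)) :
    Tendsto (fun k => |x k| + |b k|) atTop atTop := by
  have hb : Monotone b := monotone_nat_of_le_succ fun k => by
    have := h k
    have : 0 ≤ c * Real.exp (-|x k|) := by positivity
    linarith
  rcases tendsto_atTop_of_monotone hb with hb' | ⟨l, hl⟩
  · exact tendsto_atTop_mono (fun k => by linarith [abs_nonneg (x k), le_abs_self (b k)]) hb'
  · have hd : Tendsto (fun k => (b (k + 1) - b k) / c) atTop (𝓝 0) := by
      simpa using ((hl.comp (tendsto_add_atTop_nat 1)).sub hl).div_const c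
    have he : Tendsto (fun k => Real.exp (-|x k|)) atTop (𝓝 0) := by
      refine squeeze_zero (fun k => (Real.exp_pos _).le) (fun k => ?_) hd
      rw [le_div_iff₀ hc]
      linarith [h k]
    have hx : Tendsto (fun k => |x k|) atTop atTop := by
      rw [Real.tendsto_exp_comp_nhds_zero] at he
      simpa [Function.comp_def] using tendsto_neg_atBot_atTop.comp he
    exact tendsto_atTop_mono (fun k => by linarith [abs_nonneg (b k)]) hx

lemma tendsto_atTop_of_even_odd {u : ℕ → ℝ} (h0 : Tendsto (fun k => u (2 * k)) atTop atTop)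
    (h1 : Tendsto (fun k => u (2 * k + 1)) atTop atTop) : Tendsto u atTop atTop := by
  rw [tendsto_atTop_atTop] at *
  intro B
  obtain ⟨i, hi⟩ := h0 B
  obtain ⟨j, hj⟩ := h1 B
  refine ⟨2 * (i + j) + 1, fun n hn => ?_⟩
  rcases Nat.even_or_odd' n with ⟨k, rfl | rfl⟩
  · exact hi k (by omega)
  · exact hj k (by omega)

/-! ### Divergence far from equilibrium -/

namespace IsLogOddsOrbit

variable {η : ℝ} {s X Y : ℕ → ℝ}

lemma tendsto_of_le_bias_snd (h : IsLogOddsOrbit η s X Y) (hη : 0 < η) (hη' : η ≤ 1 / 100)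
    (h1 : 20 * η ≤ bias (Y 1)) : Tendsto (fun n => |X n| + |Y n|) atTop atTop := by
  -- Three steps lose at most $\tfrac92\eta$ of the initial $20\eta$. From then on each parity class
  -- of `Y` is increasing, so the threshold $15\eta$ is never crossed.
  have hall : ∀ n, 15 * η ≤ bias (Y (n + 1)) ∧ 15 * η ≤ bias (Y (n + 2)) ∧
      15 * η ≤ bias (Y (n + 3)) ∧ 15 * η ≤ bias (Y (n + 4)) := by
    intro n
    induction n with
    | zero =>
      have b2 := abs_le.1 (h.abs_bias_snd_step_le hη.le 0)
      have b3 := abs_le.1 (h.abs_bias_snd_step_le hη.le 1)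
      have b4 := abs_le.1 (h.abs_bias_snd_step_le hη.le 2)
      simp only [zero_add, Nat.reduceAdd] at *
      refine ⟨?_, ?_, ?_, ?_⟩ <;> linarith
    | succ n ih =>
      obtain ⟨i1, i2, i3, i4⟩ := ih
      refine ⟨i2, i3, i4, i3.trans (bias_mono ?_)⟩
      have := h.snd_two_step_le hη hη' n i1 i2 i3
      have : 0 ≤ 5 * η ^ 3 * Real.exp (-|X (n + 3)|) := by positivity
      exact (by linarith : Y (n + 3) ≤ Y (n + 5))
  have hstep : ∀ n, Y (n + 3) + 5 * η ^ 3 * Real.exp (-|X (n + 3)|) ≤ Y (n + 5) := fun n =>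
    h.snd_two_step_le hη hη' n (hall n).1 (hall n).2.1 (hall n).2.2.1
  have hc : 0 < 5 * η ^ 3 := by positivity
  refine (tendsto_add_atTop_iff_nat 3).1 (tendsto_atTop_of_even_odd ?_ ?_)
  · exact tendsto_abs_add_abs_of_increments (x := fun k => X (2 * k + 3))
      (b := fun k => Y (2 * k + 3)) hc fun k => hstep (2 * k)
  · exact tendsto_abs_add_abs_of_increments (x := fun k => X (2 * k + 1 + 3))
      (b := fun k => Y (2 * k + 1 + 3)) hc fun k => hstep (2 * k + 1)

lemma tendsto_of_le_abs_bias_snd (h : IsLogOddsOrbit η s X Y) (hη : 0 < η) (hη' : η ≤ 1 / 100)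
    (h1 : 20 * η ≤ |bias (Y 1)|) : Tendsto (fun n => |X n| + |Y n|) atTop atTop := by
  rcases le_abs.1 h1 with h1 | h1
  · exact h.tendsto_of_le_bias_snd hη hη' h1
  -- Two quarter turns give the symmetry $(X,Y)\mapsto(-X,-Y)$.
  · have := h.rotate.rotate.tendsto_of_le_bias_snd hη hη' (by rwa [bias_neg])
    simpa using this

/-- An orbit with a bias that is large compared to the step size diverges. -/
lemma tendsto_of_le_abs_bias (h : IsLogOddsOrbit η s X Y) (hη : 0 < η) (hη' : η ≤ 1 / 100)
    (n : ℕ) (hn : 20 * η ≤ max |bias (X (n + 1))| |bias (Y (n + 1))|) :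
    Tendsto (fun n => |X n| + |Y n|) atTop atTop := by
  refine (tendsto_add_atTop_iff_nat n).1 ?_
  have h' := h.shift n
  rcases le_max_iff.1 hn with hn | hn
  · have := h'.rotate.tendsto_of_le_abs_bias_snd hη hη'
      (by rwa [bias_neg, abs_neg, add_comm 1 n])
    simpa only [abs_neg, add_comm] using this
  · exact h'.tendsto_of_le_abs_bias_snd hη hη' (by rwa [add_comm 1 n])

/-! ### Growth near equilibrium -/

/-- Two steps in the linear regime, with an error in terms of a bound `M` for the current
log-odds. -/
lemma abs_fst_two_step_sub_le (h : IsLogOddsOrbit η s X Y) (hη : 0 < η) (hη' : η ≤ 1 / 100)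
    {n : ℕ} {M : ℝ} (hX : ∀ k, |X k| ≤ 60 * η) (hY : ∀ k, |Y k| ≤ 60 * η)
    (hXM : ∀ k ≤ 4, |X (n + k)| ≤ 8 * M) (hYM : ∀ k ≤ 4, |Y (n + k)| ≤ 8 * M) :
    |X (n + 5) - (1 + 3 / 4 * η ^ 2) * X (n + 3)| ≤ 120000 * η ^ 3 * M := by
  have hM : 0 ≤ M := by linarith [abs_nonneg (X (n + 0)), hXM 0 (by norm_num)]
  have cube : ∀ z : ℝ, |z| ≤ 60 * η → |z| ≤ 8 * M → |bias z - z / 2| ≤ 28800 * η ^ 2 * M := by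
    intro z hz hzM
    refine (abs_bias_sub_half_le (by linarith)).trans ?_
    have : |z| ^ 2 ≤ (60 * η) ^ 2 := by gcongr
    calc |z| ^ 3 = |z| ^ 2 * |z| := by ring
      _ ≤ (60 * η) ^ 2 * (8 * M) := by gcongr
      _ = _ := by ring
  have c2 := cube _ (hY (n + 2)) (hYM 2 (by norm_num))
  have c3 := cube _ (hY (n + 3)) (hYM 3 (by norm_num))
  have c4 := cube _ (hY (n + 4)) (hYM 4 (by norm_num))
  have d3 := cube _ (hX (n + 3)) (hXM 3 (by norm_num))
  have bY : ∀ k ≤ 4, |bias (Y (n + k))| ≤ 4 * M := fun k hk => by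
    linarith [abs_bias_le (Y (n + k)), hYM k hk]
  have stepX : ∀ k ≤ 3, |X (n + k + 2) - X (n + k + 1)| ≤ 12 * η * M := by
    intro k hk
    have := h.rotate.abs_snd_step_le hη.le (n + k)
    rw [show -X (n + k + 2) - -X (n + k + 1) = -(X (n + k + 2) - X (n + k + 1)) by ring,
      abs_neg] at this
    have e0 := bY k (by omega)
    have e1 := bY (k + 1) (by omega)
    rw [← add_assoc] at e1
    nlinarith
  have s2 := stepX 0 (by norm_num)
  have s3 := stepX 1 (by norm_num)
  have lip := abs_bias_sub_le (X (n + 3)) (X (n + 1))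
  have tri := abs_add_le (X (n + 3) - X (n + 2)) (X (n + 2) - X (n + 1))
  rw [sub_add_sub_cancel] at tri
  simp only [add_assoc, Nat.reduceAdd, add_zero] at s2 s3
  have x5 := h.fst_step (n + 3)
  have x4 := h.fst_step (n + 2)
  have y4 := h.snd_step (n + 2)
  have y3 := h.snd_step (n + 1)
  have a2 := h.alternating (n + 1)
  have a3 := h.alternating (n + 2)
  simp only [add_assoc, Nat.reduceAdd] at x5 x4 y4 y3 a2 a3
  have hsq : s (n + 1) ^ 2 = 1 := by rcases h.sign (n + 1) with e | e <;> simp [e]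
  have habs := h.abs_sign (n + 1)
  set e2 := bias (Y (n + 2)) - Y (n + 2) / 2 with he2
  set e3 := bias (Y (n + 3)) - Y (n + 3) / 2 with he3
  set e4 := bias (Y (n + 4)) - Y (n + 4) / 2 with he4
  set f3 := bias (X (n + 3)) - X (n + 3) / 2 with hf3
  -- Expanding $2Y_{n+4}-Y_{n+3}-Y_{n+2}$ by the dynamics cancels the bias of $X_{n+2}$ and leaves
  -- four biases of $X_{n+3}$ minus one of $X_{n+1}$. Replacing $X_{n+1}$ by $X_{n+3}$ and
  -- linearizing yields the coefficient $\tfrac12\cdot\tfrac32=\tfrac34$.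
  have key : X (n + 5) - (1 + 3 / 4 * η ^ 2) * X (n + 3) =
      η ^ 2 / 2 * (3 * f3 + (bias (X (n + 3)) - bias (X (n + 1)))) +
        s (n + 1) * (η * (2 * e4 - e3 - e2)) := by
    have v4 : bias (Y (n + 4)) = e4 + Y (n + 4) / 2 := by rw [he4]; ring
    have v3 : bias (Y (n + 3)) = e3 + Y (n + 3) / 2 := by rw [he3]; ring
    have v2 : bias (Y (n + 2)) = e2 + Y (n + 2) / 2 := by rw [he2]; ring
    rw [x5, x4, v4, v3, v2, y4, y3, a3, a2, hf3]
    linear_combination (η ^ 2 / 2 * (4 * bias (X (n + 3)) - bias (X (n + 1)))) * hsq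
  rw [key]
  have t1 : |3 * f3 + (bias (X (n + 3)) - bias (X (n + 1)))| ≤
      3 * (28800 * η ^ 2 * M) + 12 * η * M := by
    refine (abs_add_le _ _).trans (add_le_add ?_ (by linarith))
    rw [abs_mul]
    norm_num
    linarith
  have t2 : |2 * e4 - e3 - e2| ≤ 4 * (28800 * η ^ 2 * M) := by
    have := abs_sub (2 * e4 - e3) e2
    have := abs_sub (2 * e4) e3
    rw [abs_mul, abs_two] at this
    linarith
  refine (abs_add_le _ _).trans ?_
  rw [abs_mul, abs_mul (s (n + 1)), habs, one_mul, abs_mul η, abs_of_pos hη,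
    abs_of_nonneg (by positivity : 0 ≤ η ^ 2 / 2)]
  have t1' := mul_le_mul_of_nonneg_left t1 (by positivity : 0 ≤ η ^ 2 / 2)
  have t2' := mul_le_mul_of_nonneg_left t2 hη.le
  have h4 : η ^ 4 * M ≤ η ^ 3 * M / 100 := by
    have : 0 ≤ η ^ 3 * M := by positivity
    nlinarith
  nlinarith [mul_nonneg (pow_pos hη 3).le hM]

/-- The error in the two-step estimate involves earlier values, which must be controlled by the
current one. Comparability with the previous size bounds the next step by half the current size, so
it propagates; equal initial sizes start the induction. -/
lemma max_le_two_mul_max_succ (h : IsLogOddsOrbit η s X Y) (hη : 0 < η) (hη' : η ≤ 1 / 100)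
    (h0 : max |X 0| |Y 0| = max |X 1| |Y 1|) (n : ℕ) :
    max |X n| |Y n| ≤ 2 * max |X (n + 1)| |Y (n + 1)| ∧
      max |X (n + 1)| |Y (n + 1)| ≤ 2 * max |X n| |Y n| := by
  have nonneg : ∀ n, 0 ≤ max |X n| |Y n| := fun n => (abs_nonneg (X n)).trans (le_max_left _ _)
  induction n with
  | zero => rw [zero_add, h0]; constructor <;> linarith [nonneg 1]
  | succ n ih =>
    have hy := h.abs_snd_step_le hη.le n
    have hx := h.rotate.abs_snd_step_le hη.le n
    rw [neg_sub_neg, abs_sub_comm] at hx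
    set M0 := max |X n| |Y n|
    set M1 := max |X (n + 1)| |Y (n + 1)| with hM1
    have m0 : 0 ≤ M0 := nonneg n
    have m1 : 0 ≤ M1 := nonneg (n + 1)
    have x0 : |X n| ≤ M0 := le_max_left _ _
    have y0 : |Y n| ≤ M0 := le_max_right _ _
    have x1 : |X (n + 1)| ≤ M1 := le_max_left _ _
    have y1 : |Y (n + 1)| ≤ M1 := le_max_right _ _
    have hy' : |Y (n + 2) - Y (n + 1)| ≤ M1 / 2 := by
      have : 2 * |bias (X (n + 1))| + |bias (X n)| ≤ 2 * M1 := by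
        linarith [ih.1, abs_bias_le (X n), abs_bias_le (X (n + 1))]
      nlinarith
    have hx' : |X (n + 2) - X (n + 1)| ≤ M1 / 2 := by
      have : 2 * |bias (Y (n + 1))| + |bias (Y n)| ≤ 2 * M1 := by
        linarith [ih.1, abs_bias_le (Y n), abs_bias_le (Y (n + 1))]
      nlinarith
    have y2 := abs_le.1 ((abs_abs_sub_abs_le_abs_sub _ _).trans hy')
    have x2 := abs_le.1 ((abs_abs_sub_abs_le_abs_sub _ _).trans hx')
    have x3 : |X (n + 2)| ≤ max |X (n + 2)| |Y (n + 2)| := le_max_left _ _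
    have y3 : |Y (n + 2)| ≤ max |X (n + 2)| |Y (n + 2)| := le_max_right _ _
    constructor
    · rcases max_choice |X (n + 1)| |Y (n + 1)| with e | e <;> rw [← hM1] at e <;> linarith
    · exact max_le (by linarith) (by linarith)

/-- An orbit that is not at the equilibrium and starts at rest leaves the linear regime. -/
lemma exists_le_abs_bias (h : IsLogOddsOrbit η s X Y) (hη : 0 < η) (hη' : η ≤ 1 / 1000000)
    (hX01 : X 0 = X 1) (hY01 : Y 0 = Y 1) (h0 : 0 < max |X 0| |Y 0|) :
    ∃ n, 20 * η ≤ max |bias (X (n + 1))| |bias (Y (n + 1))| := by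
  by_contra! hcon
  have hall : ∀ n, |bias (X n)| < 20 * η ∧ |bias (Y n)| < 20 * η := by
    rintro (_ | n)
    · rw [hX01, hY01]; exact max_lt_iff.1 (hcon 0)
    · exact max_lt_iff.1 (hcon n)
  have small : ∀ z : ℝ, |bias z| < 20 * η → |z| ≤ 60 * η := fun z hz => by
    have := abs_le_three_mul_abs_bias (z := z) (by linarith)
    linarith
  have hX : ∀ k, |X k| ≤ 60 * η := fun k => small _ (hall k).1
  have hY : ∀ k, |Y k| ≤ 60 * η := fun k => small _ (hall k).2
  set M : ℕ → ℝ := fun n => max |X n| |Y n| with hM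
  have ratio : ∀ n, M n ≤ 2 * M (n + 1) ∧ M (n + 1) ≤ 2 * M n :=
    h.max_le_two_mul_max_succ hη (by linarith) (by rw [hX01, hY01])
  have pos : ∀ n, 0 < M n := by
    intro n
    induction n with
    | zero => exact h0
    | succ n ih => linarith [(ratio n).1]
  have near : ∀ n, ∀ k ≤ 4, M (n + k) ≤ 8 * M (n + 3) := by
    intro n k hk
    have r0 := ratio n
    have r1 := ratio (n + 1)
    have r2 := ratio (n + 2)
    have r3 := ratio (n + 3)
    simp only [add_assoc, Nat.reduceAdd] at r1 r2 r3
    have := pos (n + 3)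
    interval_cases k <;> (try rw [add_zero]) <;> linarith
  have grow : ∀ n, (1 + η ^ 2 / 2) * M (n + 3) ≤ M (n + 5) := by
    intro n
    have nX : ∀ k ≤ 4, |X (n + k)| ≤ 8 * M (n + 3) := fun k hk =>
      (le_max_left _ _).trans (near n k hk)
    have nY : ∀ k ≤ 4, |Y (n + k)| ≤ 8 * M (n + 3) := fun k hk =>
      (le_max_right _ _).trans (near n k hk)
    have gX := h.abs_fst_two_step_sub_le hη (by linarith) hX hY nX nY
    have gY := h.rotate.abs_fst_two_step_sub_le hη (by linarith) hY (by simpa using hX) nY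
      (by simpa using nX)
    have lower : ∀ a b : ℝ, |a - (1 + 3 / 4 * η ^ 2) * b| ≤ 120000 * η ^ 3 * M (n + 3) →
        |b| = M (n + 3) → (1 + η ^ 2 / 2) * M (n + 3) ≤ |a| := by
      intro a b hab hb
      have := abs_sub_abs_le_abs_sub ((1 + 3 / 4 * η ^ 2) * b) a
      rw [abs_sub_comm, abs_mul, hb, abs_of_pos (by positivity : 0 < 1 + 3 / 4 * η ^ 2)] at this
      -- Here $\eta\le10^{-6}$ is used: the error costs at most $\tfrac14$ of the gain
      -- $\tfrac34\eta^2$, leaving $\tfrac12\eta^2$.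
      have : 120000 * η ^ 3 * M (n + 3) ≤ η ^ 2 / 4 * M (n + 3) :=
        mul_le_mul_of_nonneg_right (by nlinarith [pow_pos hη 2]) (pos _).le
      linarith
    rcases max_choice |X (n + 3)| |Y (n + 3)| with e | e
    · exact (lower _ _ gX e.symm).trans (le_max_left _ _)
    · exact (lower _ _ gY e.symm).trans (le_max_right _ _)
  have geom : ∀ k, (1 + η ^ 2 / 2) ^ k * M 3 ≤ M (2 * k + 3) := by
    intro k
    induction k with
    | zero => simp
    | succ k ih =>
      calc (1 + η ^ 2 / 2) ^ (k + 1) * M 3 = (1 + η ^ 2 / 2) * ((1 + η ^ 2 / 2) ^ k * M 3) := by ring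
        _ ≤ (1 + η ^ 2 / 2) * M (2 * k + 3) := by gcongr
        _ ≤ M (2 * (k + 1) + 3) := grow (2 * k)
  obtain ⟨k, hk⟩ := pow_unbounded_of_one_lt (60 * η / M 3)
    (by linarith [pow_pos hη 2] : 1 < 1 + η ^ 2 / 2)
  rw [div_lt_iff₀ (pos 3)] at hk
  have := max_le (hX (2 * k + 3)) (hY (2 * k + 3))
  linarith [geom k]

end IsLogOddsOrbit

/-! ### From strategies to log-odds -/

/-- The log-odds of a mixed strategy with two pure strategies. -/
def logOdds (x : Fin 2 → ℝ) : ℝ := Real.log (x 0 / x 1)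

/-- Fully mixed strategies. -/
def IsFullyMixed (x : Fin 2 → ℝ) : Prop := 0 < x 0 ∧ 0 < x 1 ∧ x 0 + x 1 = 1

lemma isFullyMixed_of_mem_stdSimplex {x : Fin 2 → ℝ} (hx : x ∈ stdSimplex ℝ (Fin 2))
    (h : ∀ i, x i ≠ 0) : IsFullyMixed x :=
  ⟨(hx.1 0).lt_of_ne' (h 0), (hx.1 1).lt_of_ne' (h 1), by simpa using hx.2⟩

lemma IsFullyMixed.sigmoid_logOdds {x : Fin 2 → ℝ} (hx : IsFullyMixed x) :
    Real.sigmoid (logOdds x) = x 0 := by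
  obtain ⟨h0, h1, h⟩ := hx
  rw [logOdds, Real.sigmoid_def, Real.exp_neg, Real.exp_log (by positivity), inv_div,
    inv_eq_iff_eq_inv]
  field_simp
  exact h

lemma IsFullyMixed.bias_logOdds {x : Fin 2 → ℝ} (hx : IsFullyMixed x) :
    bias (logOdds x) = x 0 - x 1 := by
  rw [bias, hx.sigmoid_logOdds]; linarith [hx.2.2]

lemma IsFullyMixed.mwUpdate {x : Fin 2 → ℝ} (hx : IsFullyMixed x) (g : Fin 2 → ℝ) :
    IsFullyMixed (mwUpdate x g) := by
  obtain ⟨h0, h1, -⟩ := hx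
  refine ⟨?_, ?_, ?_⟩ <;> simp only [_root_.mwUpdate, Fin.sum_univ_two]
  · positivity
  · positivity
  · rw [← add_div, div_self (by positivity)]

lemma IsFullyMixed.logOdds_mwUpdate {x : Fin 2 → ℝ} (hx : IsFullyMixed x) (g : Fin 2 → ℝ) :
    logOdds (_root_.mwUpdate x g) = logOdds x + (g 0 - g 1) := by
  obtain ⟨h0, h1, -⟩ := hx
  have hs : 0 < x 0 * Real.exp (g 0) + x 1 * Real.exp (g 1) := by positivity
  rw [logOdds, logOdds, ← Real.log_exp (g 0 - g 1),
    ← Real.log_mul (by positivity) (by positivity), Real.exp_sub]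
  congr 1
  simp only [_root_.mwUpdate, Fin.sum_univ_two]
  field_simp

/-- The sign of the payoff matrix at time `t`. -/
def gameSign (t : ℤ) : ℝ := if Odd t then 1 else -1

lemma gameSign_eq (t : ℤ) : gameSign t = 1 ∨ gameSign t = -1 := by
  unfold gameSign; split_ifs <;> simp

lemma gameSign_add_one (t : ℤ) : gameSign (t + 1) = -gameSign t := by
  unfold gameSign
  by_cases h : Odd t <;> simp [h, parity_simps]

lemma gameSign_sub_one (t : ℤ) : gameSign (t - 1) = -gameSign t := by
  rw [eq_neg_iff_add_eq_zero, ← sub_add_cancel t 1, gameSign_add_one]; simp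

lemma periodicGame_transpose (t : ℤ) : (periodicGame t).transpose = periodicGame t := by
  unfold periodicGame
  split_ifs <;> ext i j <;> fin_cases i <;> fin_cases j <;> rfl

lemma periodicGame_mulVec_sub (t : ℤ) (v : Fin 2 → ℝ) :
    (periodicGame t).mulVec v 0 - (periodicGame t).mulVec v 1 = -gameSign t * (v 0 - v 1) := by
  unfold periodicGame gameSign
  split_ifs <;> simp [Matrix.mulVec, dotProduct, Fin.sum_univ_two] <;> ring

/-- Normalization drops out of log-odds. Consecutive payoff matrices are opposite, so the past
payoff that optimism subtracts reappears with a plus sign. -/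
lemma logOdds_omwuStep_fst (η : ℝ) (t : ℤ) (z' : Profile 2 2) {z : Profile 2 2}
    (hz : IsFullyMixed z.1) :
    logOdds (omwuStep η (periodicGame (t - 1)) (periodicGame t) z' z).1 =
      logOdds z.1 + -gameSign t * η * (2 * (z.2 0 - z.2 1) + (z'.2 0 - z'.2 1)) := by
  have h1 := periodicGame_mulVec_sub t z.2
  have h2 := periodicGame_mulVec_sub (t - 1) z'.2
  rw [gameSign_sub_one] at h2
  simp only [omwuStep]
  rw [hz.logOdds_mwUpdate]
  simp only [Pi.sub_apply, Pi.smul_apply, smul_eq_mul]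
  linear_combination 2 * η * h1 - η * h2

lemma logOdds_omwuStep_snd (η : ℝ) (t : ℤ) (z' : Profile 2 2) {z : Profile 2 2}
    (hz : IsFullyMixed z.2) :
    logOdds (omwuStep η (periodicGame (t - 1)) (periodicGame t) z' z).2 =
      logOdds z.2 - -gameSign t * η * (2 * (z.1 0 - z.1 1) + (z'.1 0 - z'.1 1)) := by
  have h1 := periodicGame_mulVec_sub t z.1
  have h2 := periodicGame_mulVec_sub (t - 1) z'.1
  rw [gameSign_sub_one] at h2
  simp only [omwuStep]
  rw [hz.logOdds_mwUpdate]
  simp only [Pi.sub_apply, Pi.neg_apply, Pi.smul_apply, smul_eq_mul, periodicGame_transpose]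
  linear_combination -2 * η * h1 + η * h2

lemma isFullyMixed_omwu {η : ℝ} {A : ℤ → Matrix (Fin 2) (Fin 2) ℝ} {zm z0 : Profile 2 2}
    (h1 : IsFullyMixed z0.1) (h2 : IsFullyMixed z0.2) (t : ℕ) :
    IsFullyMixed (omwu η A zm z0 t).1 ∧ IsFullyMixed (omwu η A zm z0 t).2 := by
  induction t with
  | zero => exact ⟨h1, h2⟩
  | succ t ih => exact ⟨ih.1.mwUpdate _, ih.2.mwUpdate _⟩

/-- The log-odds of the earlier profiles of the pairs from time `k` on form an orbit. -/
lemma isLogOddsOrbit_omwuPair {η : ℝ} {zm z0 : Profile 2 2} (k : ℕ)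
    (h : ∀ n, IsFullyMixed (omwuPair η periodicGame zm z0 (n + k)).1.1 ∧
      IsFullyMixed (omwuPair η periodicGame zm z0 (n + k)).1.2) :
    IsLogOddsOrbit η (fun n => -gameSign (n + k : ℕ))
      (fun n => logOdds (omwuPair η periodicGame zm z0 (n + k)).1.1)
      (fun n => logOdds (omwuPair η periodicGame zm z0 (n + k)).1.2) where
  sign n := by
    rcases gameSign_eq (n + k : ℕ) with e | e <;> rw [e] <;> simp
  alternating n := by
    rw [show n + 1 + k = (n + k) + 1 by ring]
    push_cast
    rw [gameSign_add_one]
  fst_step n := by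
    have h1 := h (n + 1)
    rw [show n + 1 + k = (n + k) + 1 by ring] at h1 ⊢
    rw [show n + 2 + k = (n + k) + 1 + 1 by ring, h1.2.bias_logOdds, (h n).2.bias_logOdds]
    exact logOdds_omwuStep_fst η (n + k : ℕ) _ h1.1
  snd_step n := by
    have h1 := h (n + 1)
    rw [show n + 1 + k = (n + k) + 1 by ring] at h1 ⊢
    rw [show n + 2 + k = (n + k) + 1 + 1 by ring, h1.1.bias_logOdds, (h n).1.bias_logOdds]
    exact logOdds_omwuStep_snd η (n + k : ℕ) _ h1.2

lemma omwu_fst_eq_zero {m n : ℕ} {η : ℝ} {A : ℤ → Matrix (Fin m) (Fin n) ℝ} {zm z0 : Profile m n}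
    {i : Fin m} (h : z0.1 i = 0) (t : ℕ) : (omwu η A zm z0 t).1 i = 0 := by
  induction t with
  | zero => exact h
  | succ t ih =>
    change mwUpdate (omwu η A zm z0 t).1 _ i = 0
    rw [mwUpdate, ih, zero_mul, zero_div]

lemma omwu_snd_eq_zero {m n : ℕ} {η : ℝ} {A : ℤ → Matrix (Fin m) (Fin n) ℝ} {zm z0 : Profile m n}
    {i : Fin n} (h : z0.2 i = 0) (t : ℕ) : (omwu η A zm z0 t).2 i = 0 := by
  induction t with
  | zero => exact h
  | succ t ih =>
    change mwUpdate (omwu η A zm z0 t).2 _ i = 0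
    rw [mwUpdate, ih, zero_mul, zero_div]

/-! ### KL-divergence from the equilibrium -/

lemma klVec_ne_bot {n : ℕ} (p q : Fin n → ℝ) : klVec p q ≠ ⊥ := by
  unfold klVec
  split_ifs
  · exact top_ne_bot
  · exact EReal.coe_ne_bot _

lemma klVec_uniform_eq_top {q : Fin 2 → ℝ} {i : Fin 2} (h : q i = 0) :
    klVec ![1 / 2, 1 / 2] q = ⊤ := by
  rw [klVec, if_pos]
  refine ⟨i, ?_, h⟩
  fin_cases i <;> norm_num

lemma klVec_uniform_eq {q : Fin 2 → ℝ} (h0 : 0 < q 0) (h1 : 0 < q 1) :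
    klVec ![1 / 2, 1 / 2] q =
      ((-Real.log 2 - (Real.log (q 0) + Real.log (q 1)) / 2 : ℝ) : EReal) := by
  rw [klVec, if_neg]
  · congr 1
    simp only [Fin.sum_univ_two, Matrix.cons_val_zero, Matrix.cons_val_one]
    rw [Real.log_div (by norm_num) h0.ne', Real.log_div (by norm_num) h1.ne', one_div,
      Real.log_inv]
    ring
  · rintro ⟨i, -, hi⟩
    fin_cases i
    · exact h0.ne' hi
    · exact h1.ne' hi

/-- The divergence is $-\ln 2-\tfrac12\ln(x_0x_1)$, and $x_0x_1\le e^{-|z|}$ for log-odds $z$. -/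
lemma IsFullyMixed.le_klVec_uniform {x : Fin 2 → ℝ} (hx : IsFullyMixed x) :
    ((|logOdds x| / 2 - Real.log 2 : ℝ) : EReal) ≤ klVec ![1 / 2, 1 / 2] x := by
  rw [klVec_uniform_eq hx.1 hx.2.1, EReal.coe_le_coe_iff, ← Real.log_mul hx.1.ne' hx.2.1.ne']
  have h := sigmoid_mul_le (logOdds x)
  rw [hx.sigmoid_logOdds, show 1 - x 0 = x 1 by linarith [hx.2.2]] at h
  have := Real.log_le_log (mul_pos hx.1 hx.2.1) h
  rw [Real.log_exp] at this
  linarith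

lemma klVec_uniform_le {q : Fin 2 → ℝ} (h0 : 1 / 4 < q 0) (h1 : 1 / 4 < q 1) :
    klVec ![1 / 2, 1 / 2] q ≤ ((Real.log 2 : ℝ) : EReal) := by
  rw [klVec_uniform_eq (by linarith) (by linarith), EReal.coe_le_coe_iff]
  have e : Real.log (1 / 4) = -(2 * Real.log 2) := by
    rw [one_div, Real.log_inv, show (4 : ℝ) = 2 ^ 2 by norm_num, Real.log_pow]; norm_num
  have l0 := Real.log_le_log (by norm_num) h0.le
  have l1 := Real.log_le_log (by norm_num) h1.le
  linarith

/-- A sequence of profiles with divergent KL-divergence does not converge to the equilibrium. -/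
lemma not_tendsto_equilibrium {z : ℕ → Profile 2 2}
    (h : Tendsto (fun t => klProfile equilibrium (z t)) atTop (𝓝 ⊤)) :
    ¬ Tendsto z atTop (𝓝 equilibrium) := by
  intro hz
  have h1 : ∀ i, ∀ᶠ t in atTop, 1 / 4 < (z t).1 i := fun i => by
    refine (tendsto_pi_nhds.1 hz.fst_nhds i).eventually_const_lt ?_
    fin_cases i <;> norm_num [equilibrium]
  have h2 : ∀ i, ∀ᶠ t in atTop, 1 / 4 < (z t).2 i := fun i => by
    refine (tendsto_pi_nhds.1 hz.snd_nhds i).eventually_const_lt ?_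
    fin_cases i <;> norm_num [equilibrium]
  have h3 := EReal.tendsto_nhds_top_iff_real.1 h (Real.log 2 + Real.log 2)
  obtain ⟨t, a0, a1, b0, b1, hk⟩ :=
    ((h1 0).and ((h1 1).and ((h2 0).and ((h2 1).and h3)))).exists
  have := add_le_add (klVec_uniform_le a0 a1) (klVec_uniform_le b0 b1)
  rw [← EReal.coe_add] at this
  exact absurd hk (not_lt.2 this)

lemma tendsto_klProfile_of_logOdds {z : ℕ → Profile 2 2}
    (hz : ∀ t, IsFullyMixed (z t).1 ∧ IsFullyMixed (z t).2)
    (h : Tendsto (fun t => |logOdds (z t).1| + |logOdds (z t).2|) atTop atTop) :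
    Tendsto (fun t => klProfile equilibrium (z t)) atTop (𝓝 ⊤) := by
  refine EReal.tendsto_nhds_top_iff_real.2 fun B => ?_
  filter_upwards [h.eventually_gt_atTop (2 * (B + 2 * Real.log 2))] with t ht
  refine lt_of_lt_of_le ?_ (add_le_add (hz t).1.le_klVec_uniform (hz t).2.le_klVec_uniform)
  rw [← EReal.coe_add, EReal.coe_lt_coe_iff]
  linarith

lemma klProfile_equilibrium_eq_top {z : Profile 2 2}
    (h : (∃ i, z.1 i = 0) ∨ ∃ i, z.2 i = 0) : klProfile equilibrium z = ⊤ := by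
  rcases h with ⟨i, hi⟩ | ⟨i, hi⟩
  · rw [klProfile, equilibrium, klVec_uniform_eq_top hi, EReal.top_add_of_ne_bot (klVec_ne_bot _ _)]
  · rw [klProfile, equilibrium, klVec_uniform_eq_top hi, EReal.add_top_of_ne_bot (klVec_ne_bot _ _)]

/-! ### Divergence from the given initial conditions -/

/-- The divergence has to be proved only for fully mixed starting points. -/
lemma tendsto_klProfile_of_fullyMixed {η : ℝ} {zm z0 : Profile 2 2} (hz : z0 ∈ mixedProfiles 2 2)
    (h : IsFullyMixed z0.1 → IsFullyMixed z0.2 →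
      Tendsto (fun t => |logOdds (omwu η periodicGame zm z0 t).1| +
        |logOdds (omwu η periodicGame zm z0 t).2|) atTop atTop) :
    Tendsto (fun t => klProfile equilibrium (omwu η periodicGame zm z0 t)) atTop (𝓝 ⊤) := by
  by_cases hb : (∃ i, z0.1 i = 0) ∨ ∃ i, z0.2 i = 0
  · have : ∀ t, klProfile equilibrium (omwu η periodicGame zm z0 t) = ⊤ := fun t =>
      klProfile_equilibrium_eq_top <| hb.imp (fun ⟨i, hi⟩ => ⟨i, omwu_fst_eq_zero hi t⟩)
        fun ⟨i, hi⟩ => ⟨i, omwu_snd_eq_zero hi t⟩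
    simp only [this, tendsto_const_nhds]
  · push Not at hb
    have h1 := isFullyMixed_of_mem_stdSimplex hz.1 hb.1
    have h2 := isFullyMixed_of_mem_stdSimplex hz.2 hb.2
    exact tendsto_klProfile_of_logOdds (isFullyMixed_omwu h1 h2) (h h1 h2)

lemma abs_sub_le_one_of_mem_stdSimplex {x : Fin 2 → ℝ} (hx : x ∈ stdSimplex ℝ (Fin 2)) :
    |x 0 - x 1| ≤ 1 := by
  have h : x 0 + x 1 = 1 := by simpa using hx.2
  rw [abs_le]
  constructor <;> linarith [hx.1 0, hx.1 1]

lemma abs_bias_add_sub_le {η σ a b w : ℝ} (hη : 0 ≤ η) (hσ : σ = 1 ∨ σ = -1) (ha : |a| ≤ 1)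
    (hb : |b| ≤ 1) : |bias w| - 2 * η ≤ |bias (w + σ * η * (2 * a + b))| := by
  have hσ' : |σ| = 1 := by rcases hσ with e | e <;> simp [e]
  have h1 := abs_bias_sub_le w (w + σ * η * (2 * a + b))
  rw [sub_add_cancel_left, abs_neg, abs_mul, abs_mul, hσ', one_mul, abs_of_nonneg hη] at h1
  have h2 : |2 * a + b| ≤ 3 := by
    refine (abs_add_le _ _).trans ?_
    rw [abs_mul, abs_two]
    linarith
  have h3 := abs_sub_abs_le_abs_sub (bias w) (bias (w + σ * η * (2 * a + b)))
  nlinarith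

/-- Divergence when the initial bias is large compared to the step size. -/
lemma tendsto_logOdds_of_large_bias {η : ℝ} (hη : 0 < η) (hη' : η ≤ 1 / 100) {zm z0 : Profile 2 2}
    (hzm : zm ∈ mixedProfiles 2 2) (h1 : IsFullyMixed z0.1) (h2 : IsFullyMixed z0.2)
    (h : 22 * η ≤ max |z0.1 0 - z0.1 1| |z0.2 0 - z0.2 1|) :
    Tendsto (fun t => |logOdds (omwu η periodicGame zm z0 t).1| +
      |logOdds (omwu η periodicGame zm z0 t).2|) atTop atTop := by
  -- The orbit begins at time 0, because `zm` may lie on the boundary. The threshold is then needed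
  -- at time 1, and the step there costs at most $2\eta$ of the $22\eta$.
  have horbit := isLogOddsOrbit_omwuPair (η := η) (zm := zm) 1
    fun n => isFullyMixed_omwu (A := periodicGame) h1 h2 n
  refine horbit.tendsto_of_le_abs_bias hη hη' 0 ?_
  have e1 := logOdds_omwuStep_fst η 0 zm h1
  have e2 := logOdds_omwuStep_snd η 0 zm h2
  change 20 * η ≤ max |bias (logOdds (omwuStep η (periodicGame (0 - 1)) (periodicGame 0) zm z0).1)|
    |bias (logOdds (omwuStep η (periodicGame (0 - 1)) (periodicGame 0) zm z0).2)|
  have hs : -gameSign 0 = 1 ∨ -gameSign 0 = -1 := by simp [gameSign]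
  rw [e1, e2, sub_eq_add_neg (logOdds z0.2), ← neg_mul, ← neg_mul, neg_neg]
  have b1 := abs_bias_add_sub_le (w := logOdds z0.1) hη.le hs
    (h2.bias_logOdds ▸ abs_bias_le_one _) (abs_sub_le_one_of_mem_stdSimplex hzm.2)
  have b2 := abs_bias_add_sub_le (w := logOdds z0.2) hη.le (gameSign_eq 0)
    (h1.bias_logOdds ▸ abs_bias_le_one _) (abs_sub_le_one_of_mem_stdSimplex hzm.1)
  rw [h1.bias_logOdds] at b1
  rw [h2.bias_logOdds] at b2
  rcases le_max_iff.1 h with h | h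
  · exact le_max_of_le_left (by linarith)
  · exact le_max_of_le_right (by linarith)

/-- Divergence when the dynamics start at rest outside the equilibrium. -/
lemma tendsto_logOdds_of_rest {η : ℝ} (hη : 0 < η) (hη' : η ≤ 1 / 1000000) {z0 : Profile 2 2}
    (hne : z0 ≠ equilibrium) (h1 : IsFullyMixed z0.1) (h2 : IsFullyMixed z0.2) :
    Tendsto (fun t => |logOdds (omwu η periodicGame z0 z0 t).1| +
      |logOdds (omwu η periodicGame z0 z0 t).2|) atTop atTop := by
  -- This orbit includes time $-1$, so that its first two entries coincide.
  have horbit := isLogOddsOrbit_omwuPair (η := η) (zm := z0) (z0 := z0) 0 fun n => by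
    cases n with
    | zero => exact ⟨h1, h2⟩
    | succ n => exact isFullyMixed_omwu h1 h2 n
  have hpos : 0 < max |logOdds z0.1| |logOdds z0.2| := by
    by_contra! hle
    have uniform : ∀ x : Fin 2 → ℝ, IsFullyMixed x → |logOdds x| ≤ 0 → x = ![1 / 2, 1 / 2] := by
      intro x hx h0
      have hb := hx.bias_logOdds
      rw [abs_nonpos_iff.1 h0, bias_zero] at hb
      have := hx.2.2
      ext i
      fin_cases i <;> simp <;> linarith
    obtain ⟨l1, l2⟩ := max_le_iff.1 hle
    exact hne (Prod.ext (uniform _ h1 l1) (uniform _ h2 l2))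
  obtain ⟨n, hn⟩ := horbit.exists_le_abs_bias hη hη' rfl rfl hpos
  exact (tendsto_add_atTop_iff_nat 1).2 (horbit.tendsto_of_le_abs_bias hη (by linarith) n hn)

end

theorem mainTheorem1 :
    (∀ z0 ∈ mixedProfiles 2 2, z0 ≠ equilibrium → ∀ zm ∈ mixedProfiles 2 2, ∀ η : ℝ, 0 < η →
      16 * Real.sqrt η ≤
        (1 / 2) * max |z0.1 0 - equilibrium.1 0| |z0.2 0 - equilibrium.2 0| →
      Tendsto (fun t => klProfile equilibrium (omwu η periodicGame zm z0 t)) atTop (𝓝 ⊤) ∧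
      ¬ Tendsto (fun t => omwu η periodicGame zm z0 t) atTop (𝓝 equilibrium)) ∧
    (∃ η₀ : ℝ, 0 < η₀ ∧ ∀ η : ℝ, 0 < η → η < η₀ →
      ∀ z0 ∈ mixedProfiles 2 2, z0 ≠ equilibrium →
      Tendsto (fun t => klProfile equilibrium (omwu η periodicGame z0 z0 t)) atTop (𝓝 ⊤) ∧
      ¬ Tendsto (fun t => omwu η periodicGame z0 z0 t) atTop (𝓝 equilibrium)) := by
  refine ⟨fun z0 hz0 _ zm hzm η hη hp => ?_, 1 / 1000000, by norm_num, fun η hη hη' z0 hz0 hne => ?_⟩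
  · have key := tendsto_klProfile_of_fullyMixed (η := η) (zm := zm) hz0 fun h1 h2 => by
      have hhalf : ∀ x : Fin 2 → ℝ, IsFullyMixed x →
          2 * |x 0 - 1 / 2| = |x 0 - x 1| ∧ |x 0 - x 1| ≤ 1 := by
        intro x hx
        refine ⟨?_, hx.bias_logOdds ▸ abs_bias_le_one _⟩
        rw [← abs_two, ← abs_mul, abs_two]
        congr 1
        linarith [hx.2.2]
      obtain ⟨e1, l1⟩ := hhalf _ h1
      obtain ⟨e2, l2⟩ := hhalf _ h2
      -- A bias is twice the deviation from $\tfrac12$, so $64=16\cdot2\cdot2$. As biases are at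
      -- most 1, $\sqrt\eta\le\tfrac1{64}$, which gives both $\eta\le\tfrac1{100}$ and
      -- $22\eta\le64\sqrt\eta$.
      have hp' : 64 * Real.sqrt η ≤ max |z0.1 0 - z0.1 1| |z0.2 0 - z0.2 1| := by
        rw [← e1, ← e2, ← mul_max_of_nonneg _ _ (by norm_num)]
        simp only [equilibrium, Matrix.cons_val_zero] at hp
        linarith
      have hsq := Real.sq_sqrt hη.le
      have hsqrt : Real.sqrt η ≤ 1 / 64 := by linarith [max_le l1 l2]
      have h0 := Real.sqrt_nonneg η
      exact tendsto_logOdds_of_large_bias hη (by nlinarith) hzm h1 h2 (by nlinarith)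
    exact ⟨key, not_tendsto_equilibrium key⟩
  · have key := tendsto_klProfile_of_fullyMixed (η := η) (zm := z0) hz0
      (tendsto_logOdds_of_rest hη hη'.le hne)
    exact ⟨key, not_tendsto_equilibrium key⟩
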